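/- Let $\mathbb{F}_q$ be a finite field. A $q$-matroid $M=(E,r)$ consists of a finite-dimensional $\mathbb{F}_q$-space $E$ and an integer-valued function $r$ on the subspaces of $E$ with $0\le r(A)\le\dim A$, with $r(A)\le r(B)$ whenever $A\le B$, and with $r(A+B)+r(A\cap B)\le r(A)+r(B)$ for all subspaces $A,B\le E$. A subspace $A$ is independent if $r(A)=\dim A$ and dependent otherwise; circuits are the inclusion-minimal dependent subspaces; a subspace is cyclic if it is a (possibly empty) sum of circuits; a subspace $A$ is a flat if it is inclusion-maximal among the subspaces of rank $r(A)$; a cyclic flat is a subspace that is both cyclic and a flat. A subspace $A\le E$ is a free separator of $M$ if every cyclic flat $Z$ of $M$ satisfies $Z\le A$ or $A\le Z$; it is non-trivial if $A\ne 0$ and $A\neq E$. For $A\le E$, the restriction $M|A$ is the $q$-matroid on $A$ with rank function $T\mapsto r(T)$, and the contraction $M/A$ is the $q$-matroid on $E/A$ with rank function $T\mapsto r(\pi^{-1}(T))-r(A)$, where $\pi:E\to E/A$ is the canonical projection. Two $q$-matroids $(E,r)$ and $(E',r')$ are isomorphic if there is a linear isomorphism $\tau:E\to E'$ with $r'(\tau(V))=r(V)$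 for all $V\le E$. For $q$-matroids $M_1=(E_1,r_1)$ and $M_2=(E_2,r_2)$, with projections $\pi_i:E_1\oplus E_2\to E_i$, the free product $M_1\square M_2$ is the $q$-matroid on $E_1\oplus E_2$ whose independent spaces are the subspaces $I\le E_1\oplus E_2$ such that $I_1:=\pi_1(I\cap(E_1\oplus 0))$ is independent in $M_1$ and $r_1(E_1)-r_1(I_1)\ge\dim\pi_2(I)-r_2(\pi_2(I))$; its rank function is $X\mapsto\max\{\dim (X\cap I): I \text{ independent}\}$. A $q$-matroid is irreducible if it is not isomorphic to a free product of two $q$-matroids with non-zero ground spaces. (1) Let $E_1,E_2$ be finite-dimensional $\mathbb{F}_q$-spaces and let $M$ be a $q$-matroid on $E_1\oplus E_2$. Then $$M=(M|(E_1\oplus 0))\,\square\,(M/(E_1\oplus 0))$$ (where $E_1\oplus 0$ is identified with $E_1$, and $(E_1\oplus E_2)/(E_1\oplus 0)$ with $E_2$ via the second projection) if and only if $E_1\oplus 0$ is a free separator of $M$. (2) Let $M$ be a $q$-matroid with non-zero ground space. Then $M$ is irreducible if and only if it has no non-trivial free separator. -/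

import Mathlib

universe u v w t

/-- A `q`-matroid on the ground space `E`, given by its rank function on the lattice of subspaces
of `E`. -/
@[ext]
structure QMatroid (K : Type v) (E : Type u) [Field K] [AddCommGroup E] [Module K E] where
  /-- the rank function -/
  r : Submodule K E → ℕ
  rank_le : ∀ A, r A ≤ Module.finrank K A
  mono : ∀ A B, A ≤ B → r A ≤ r B
  submod : ∀ A B, r (A ⊔ B) + r (A ⊓ B) ≤ r A + r B

namespace QMatroid

section Basic

variable {K : Type v} {E : Type u} [Field K] [AddCommGroup E] [Module K E]

/-- Independent spaces. -/
def Indep (M : QMatroid K E) (A : Submodule K E) : Prop := M.r A = Module.finrank K A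

/-- Circuits: the inclusion-minimal dependent spaces. -/
def IsCircuit (M : QMatroid K E) (C : Submodule K E) : Prop := Minimal (fun A => ¬ M.Indep A) C

/-- Cyclic spaces: sums of circuits (the zero space being the empty sum). -/
def IsCyclic (M : QMatroid K E) (A : Submodule K E) : Prop :=
  ∃ S : Set (Submodule K E), (∀ C ∈ S, M.IsCircuit C) ∧ A = sSup S

/-- Flats: spaces that are inclusion-maximal among the spaces of the same rank. -/
def IsFlat (M : QMatroid K E) (A : Submodule K E) : Prop := Maximal (fun V => M.r V = M.r A) A

/-- Cyclic flats. -/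
def IsCyclicFlat (M : QMatroid K E) (A : Submodule K E) : Prop := M.IsFlat A ∧ M.IsCyclic A

/-- Free separators: spaces comparable with every cyclic flat. -/
def IsFreeSeparator (M : QMatroid K E) (A : Submodule K E) : Prop :=
  ∀ Z, M.IsCyclicFlat Z → Z ≤ A ∨ A ≤ Z

/-- The rank-lack function. -/
def rankLack (M : QMatroid K E) (A : Submodule K E) : ℕ := M.r ⊤ - M.r A

/-- The nullity function. -/
noncomputable def nullity (M : QMatroid K E) (A : Submodule K E) : ℕ := Module.finrank K A - M.r A

/-- Isomorphism of `q`-matroids. -/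
def Iso {E' : Type w} [AddCommGroup E'] [Module K E'] (M : QMatroid K E) (M' : QMatroid K E') :
    Prop :=
  ∃ τ : E ≃ₗ[K] E', ∀ V : Submodule K E, M'.r (V.map τ.toLinearMap) = M.r V

/-- The `q`-matroid obtained from `M` by identifying its ground space `E` with `E'` along `e`. -/
def map {E' : Type w} [AddCommGroup E'] [Module K E'] (M : QMatroid K E) (e : E ≃ₗ[K] E') :
    QMatroid K E' where
  r V := M.r (V.map e.symm.toLinearMap)
  rank_le V := (M.rank_le _).trans_eq (LinearEquiv.finrank_map_eq e.symm V)
  mono A B h := M.mono _ _ (Submodule.map_mono h)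
  submod A B := by
    rw [Submodule.map_sup, Submodule.map_inf _ e.symm.injective]
    exact M.submod _ _

/-- The restriction `M|A`, with ground space `A`. -/
def restrict (M : QMatroid K E) (A : Submodule K E) : QMatroid K A where
  r T := M.r (T.map A.subtype)
  rank_le T := (M.rank_le _).trans_eq (Submodule.finrank_map_subtype_eq A T)
  mono S T h := M.mono _ _ (Submodule.map_mono h)
  submod S T := by
    rw [Submodule.map_sup, Submodule.map_inf _ A.injective_subtype]
    exact M.submod _ _

variable [FiniteDimensional K E]

theorem rank_add_finrank_le (M : QMatroid K E) (A B : Submodule K E) (h : A ≤ B) :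
    M.r B + Module.finrank K A ≤ M.r A + Module.finrank K B := by
  obtain ⟨C, hC⟩ := Submodule.exists_isCompl A
  have h1 : A ⊔ B ⊓ C = B := by
    rw [inf_comm, ← sup_inf_assoc_of_le C h, hC.sup_eq_top, top_inf_eq]
  have h2 : A ⊓ (B ⊓ C) = ⊥ := by
    rw [inf_left_comm, hC.inf_eq_bot, inf_bot_eq]
  have h3 := Submodule.finrank_sup_add_finrank_inf_eq A (B ⊓ C)
  have h4 := M.submod A (B ⊓ C)
  have h5 := M.rank_le (B ⊓ C)
  rw [h1, h2] at h3 h4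
  simp only [finrank_bot] at h3
  omega

theorem finrank_map_add_finrank_inf_ker {E' : Type w} [AddCommGroup E'] [Module K E']
    (f : E →ₗ[K] E') (X : Submodule K E) :
    Module.finrank K (X.map f) + Module.finrank K (X ⊓ LinearMap.ker f : Submodule K E) =
      Module.finrank K X := by
  have h := LinearMap.finrank_range_add_finrank_ker (f.domRestrict X)
  rw [LinearMap.range_domRestrict] at h
  have h2 : X ⊓ LinearMap.ker f = (LinearMap.ker (f.domRestrict X)).map X.subtype := by
    ext x
    simp [and_comm]
  rw [← h, h2, Submodule.finrank_map_subtype_eq]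

/-- The contraction `M/A`, with ground space `E ⧸ A`. -/
def contract (M : QMatroid K E) (A : Submodule K E) : QMatroid K (E ⧸ A) where
  r T := M.r (T.comap A.mkQ) - M.r A
  rank_le T := by
    have hA : A ≤ T.comap A.mkQ := A.le_comap_mkQ T
    have h1 := M.rank_add_finrank_le A _ hA
    have h2 := finrank_map_add_finrank_inf_ker A.mkQ (T.comap A.mkQ)
    rw [Submodule.map_comap_eq_of_surjective A.mkQ_surjective, Submodule.ker_mkQ,
      inf_eq_right.2 hA] at h2
    omega
  mono S T h := Nat.sub_le_sub_right (M.mono _ _ (Submodule.comap_mono h)) _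
  submod S T := by
    have e1 : (S ⊔ T).comap A.mkQ = S.comap A.mkQ ⊔ T.comap A.mkQ := by
      conv_lhs => rw [← Submodule.map_comap_eq_of_surjective A.mkQ_surjective S,
        ← Submodule.map_comap_eq_of_surjective A.mkQ_surjective T]
      rw [← Submodule.map_sup, Submodule.comap_map_mkQ, sup_eq_right]
      exact (A.le_comap_mkQ S).trans le_sup_left
    have h0 := M.submod (S.comap A.mkQ) (T.comap A.mkQ)
    have h1 := M.mono _ _ (A.le_comap_mkQ S)
    have h2 := M.mono _ _ (A.le_comap_mkQ T)
    have h3 := M.mono _ _ (A.le_comap_mkQ (S ⊓ T))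
    have h4 := M.mono _ _ (A.le_comap_mkQ (S ⊔ T))
    rw [e1] at h4 ⊢
    rw [Submodule.comap_inf] at h3 ⊢
    omega

theorem exists_indep_le (M : QMatroid K E) (X : Submodule K E) :
    ∃ I ≤ X, M.Indep I ∧ M.r X = Module.finrank K I := by
  have hbot : M.Indep (⊥ : Submodule K E) := by
    have h := M.rank_le ⊥
    simp only [finrank_bot] at h
    simp only [Indep, finrank_bot]
    omega
  obtain ⟨I, ⟨hIX, hI⟩, hmax⟩ := WellFounded.has_min
    (wellFounded_gt (α := Submodule K E)) {I | I ≤ X ∧ M.Indep I} ⟨⊥, bot_le, hbot⟩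
  obtain ⟨J, ⟨hIJ, hJX, hJ⟩, hJmax⟩ := WellFounded.has_min
    (wellFounded_gt (α := Submodule K E)) {J | I ≤ J ∧ J ≤ X ∧ M.r J = M.r I}
    ⟨I, le_rfl, hIX, rfl⟩
  refine ⟨I, hIX, hI, ?_⟩
  have hJX' : J = X := by
    by_contra hne
    obtain ⟨x, hxX, hxJ⟩ := SetLike.exists_of_lt (lt_of_le_of_ne hJX hne)
    have hsX : Submodule.span K {x} ≤ X := (Submodule.span_singleton_le_iff_mem x X).2 hxX
    have hlt : ∀ L : Submodule K E, L ≤ J → L < L ⊔ Submodule.span K {x} := fun L hL =>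
      lt_of_le_of_ne le_sup_left fun h => hxJ <| hL <| by
        rw [h]
        exact Submodule.mem_sup_right (Submodule.mem_span_singleton_self x)
    have hr : M.r (I ⊔ Submodule.span K {x}) = M.r I := by
      refine le_antisymm ?_ (M.mono _ _ le_sup_left)
      by_contra hcon
      refine hmax (I ⊔ Submodule.span K {x}) ⟨sup_le hIX hsX, ?_⟩ (hlt I hIJ)
      have h1 := M.rank_le (I ⊔ Submodule.span K {x})
      have h2 := Submodule.finrank_sup_add_finrank_inf_eq I (Submodule.span K {x})
      have h3 : Module.finrank K (Submodule.span K {x}) ≤ 1 := by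
        simpa using finrank_span_le_card (R := K) ({x} : Set E)
      unfold Indep at hI ⊢
      omega
    refine hJmax (J ⊔ Submodule.span K {x}) ⟨hIJ.trans le_sup_left, sup_le hJX hsX, ?_⟩ (hlt J le_rfl)
    have h1 := M.submod J (I ⊔ Submodule.span K {x})
    rw [← sup_assoc, sup_eq_left.2 hIJ] at h1
    have h2 := M.mono I (J ⊓ (I ⊔ Submodule.span K {x})) (le_inf hIJ le_sup_left)
    have h3 := M.mono J (J ⊔ Submodule.span K {x}) le_sup_left
    omega
  rw [← hJX', hJ]
  exact hI

theorem indep_of_le (M : QMatroid K E) (I J : Submodule K E) (h : I ≤ J) (hJ : M.Indep J) :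
    M.Indep I := by
  have h1 := M.rank_add_finrank_le I J h
  have h2 := M.rank_le I
  unfold Indep at *
  omega

theorem sSup_indep_eq_rank (M : QMatroid K E) (X : Submodule K E) :
    sSup {n | ∃ I, M.Indep I ∧ n = Module.finrank K (X ⊓ I : Submodule K E)} = M.r X := by
  obtain ⟨I, hIX, hI, hr⟩ := M.exists_indep_le X
  refine IsGreatest.csSup_eq ⟨⟨I, hI, by rw [inf_eq_right.2 hIX, hr]⟩, ?_⟩
  rintro n ⟨J, hJ, rfl⟩
  have h : M.Indep (X ⊓ J) := M.indep_of_le _ _ inf_le_right hJ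
  rw [← h]
  exact M.mono _ _ inf_le_left

end Basic

section FreeProduct

open LinearMap (inl fst snd)

variable {K : Type v} {E₁ : Type u} {E₂ : Type w} [Field K]
  [AddCommGroup E₁] [Module K E₁] [AddCommGroup E₂] [Module K E₂]

/-- The space `E₁ ⊕ 0` inside `E₁ ⊕ E₂`. -/
abbrev left (K : Type v) (E₁ : Type u) (E₂ : Type w) [Field K]
    [AddCommGroup E₁] [Module K E₁] [AddCommGroup E₂] [Module K E₂] : Submodule K (E₁ × E₂) :=
  LinearMap.range (inl K E₁ E₂)

/-- The collection of spaces `I ≤ E₁ ⊕ E₂` such that `π₁(I ∩ ι₁(E₁))` is independent in `M₁` and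
its rank-lack in `M₁` is at least the nullity of `π₂(I)` in `M₂`. -/
def freeIndep (M₁ : QMatroid K E₁) (M₂ : QMatroid K E₂) : Set (Submodule K (E₁ × E₂)) :=
  {I | M₁.Indep ((I ⊓ left K E₁ E₂).map (fst K E₁ E₂)) ∧
    M₁.rankLack ((I ⊓ left K E₁ E₂).map (fst K E₁ E₂)) ≥ M₂.nullity (I.map (snd K E₁ E₂))}

theorem map_fst_inf_left (X : Submodule K (E₁ × E₂)) :
    (X ⊓ left K E₁ E₂).map (fst K E₁ E₂) = X.comap (inl K E₁ E₂) := by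
  ext x
  simp only [Submodule.mem_map, Submodule.mem_inf, LinearMap.mem_range, Submodule.mem_comap]
  constructor
  · rintro ⟨_, ⟨hX, y, rfl⟩, rfl⟩
    exact hX
  · intro h
    exact ⟨_, ⟨h, x, rfl⟩, rfl⟩

variable [FiniteDimensional K E₁] [FiniteDimensional K E₂]

theorem finrank_comap_inl_add (X : Submodule K (E₁ × E₂)) :
    Module.finrank K (X.comap (inl K E₁ E₂)) + Module.finrank K (X.map (snd K E₁ E₂)) =
      Module.finrank K X := by
  have h := finrank_map_add_finrank_inf_ker (snd K E₁ E₂) X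
  have h2 : (X.comap (inl K E₁ E₂)).map (inl K E₁ E₂) = X ⊓ LinearMap.ker (snd K E₁ E₂) := by
    rw [Submodule.map_comap_eq, LinearMap.range_inl, inf_comm]
  rw [← h, ← h2, ← (Submodule.equivMapOfInjective _ LinearMap.inl_injective _).finrank_eq,
    add_comm]

/-- An auxiliary `q`-matroid, used only to verify the axioms for the free product. -/
noncomputable def freeAux (M₁ : QMatroid K E₁) (M₂ : QMatroid K E₂) : QMatroid K (E₁ × E₂) where
  r X := min (M₁.r (X.comap (inl K E₁ E₂)) + Module.finrank K (X.map (snd K E₁ E₂)))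
    (M₁.r ⊤ + M₂.r (X.map (snd K E₁ E₂)))
  rank_le X := by
    have h1 := finrank_comap_inl_add X
    have h2 := M₁.rank_le (X.comap (inl K E₁ E₂))
    omega
  mono X Y h := by
    have h1 := M₁.mono _ _ (Submodule.comap_mono (f := inl K E₁ E₂) h)
    have h2 := M₂.mono _ _ (Submodule.map_mono (f := snd K E₁ E₂) h)
    have h3 := Submodule.finrank_mono (Submodule.map_mono (f := snd K E₁ E₂) h)
    omega
  submod X Y := by
    have key : ∀ X Y : Submodule K (E₁ × E₂),
        (M₁.r ⊤ + M₂.r ((X ⊔ Y).map (snd K E₁ E₂))) +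
          (M₁.r ((X ⊓ Y).comap (inl K E₁ E₂)) + Module.finrank K ((X ⊓ Y).map (snd K E₁ E₂))) ≤
        (M₁.r (X.comap (inl K E₁ E₂)) + Module.finrank K (X.map (snd K E₁ E₂))) +
          (M₁.r ⊤ + M₂.r (Y.map (snd K E₁ E₂))) := by
      intro X Y
      have h1 := M₁.mono _ _ (Submodule.comap_mono (f := inl K E₁ E₂) (inf_le_left : X ⊓ Y ≤ X))
      have h2 := M₂.rank_add_finrank_le (Y.map (snd K E₁ E₂))
        (X.map (snd K E₁ E₂) ⊔ Y.map (snd K E₁ E₂)) le_sup_right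
      have h3 := Submodule.finrank_sup_add_finrank_inf_eq
        (X.map (snd K E₁ E₂)) (Y.map (snd K E₁ E₂))
      have h4 := Submodule.finrank_mono (Submodule.map_inf_le (snd K E₁ E₂) (p := X) (q := Y))
      rw [Submodule.map_sup]
      omega
    have hXY := key X Y
    have hYX := key Y X
    rw [sup_comm, inf_comm] at hYX
    have hg : M₂.r ((X ⊔ Y).map (snd K E₁ E₂)) + M₂.r ((X ⊓ Y).map (snd K E₁ E₂)) ≤
        M₂.r (X.map (snd K E₁ E₂)) + M₂.r (Y.map (snd K E₁ E₂)) := by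
      have h1 := M₂.submod (X.map (snd K E₁ E₂)) (Y.map (snd K E₁ E₂))
      have h2 := M₂.mono _ _ (Submodule.map_inf_le (snd K E₁ E₂) (p := X) (q := Y))
      rw [Submodule.map_sup]
      omega
    have hf : (M₁.r ((X ⊔ Y).comap (inl K E₁ E₂)) +
          Module.finrank K ((X ⊔ Y).map (snd K E₁ E₂))) +
        (M₁.r ((X ⊓ Y).comap (inl K E₁ E₂)) + Module.finrank K ((X ⊓ Y).map (snd K E₁ E₂))) ≤
        (M₁.r (X.comap (inl K E₁ E₂)) + Module.finrank K (X.map (snd K E₁ E₂))) +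
        (M₁.r (Y.comap (inl K E₁ E₂)) + Module.finrank K (Y.map (snd K E₁ E₂))) := by
      have a1 := finrank_comap_inl_add X
      have a2 := finrank_comap_inl_add Y
      have a3 := finrank_comap_inl_add (X ⊔ Y)
      have a4 := finrank_comap_inl_add (X ⊓ Y)
      have a5 := Submodule.finrank_sup_add_finrank_inf_eq X Y
      have a6 := Submodule.finrank_sup_add_finrank_inf_eq
        (X.comap (inl K E₁ E₂)) (Y.comap (inl K E₁ E₂))
      have a7 := M₁.submod (X.comap (inl K E₁ E₂)) (Y.comap (inl K E₁ E₂))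
      have a8 := M₁.rank_add_finrank_le
        (X.comap (inl K E₁ E₂) ⊔ Y.comap (inl K E₁ E₂)) ((X ⊔ Y).comap (inl K E₁ E₂))
        (sup_le (Submodule.comap_mono le_sup_left) (Submodule.comap_mono le_sup_right))
      rw [Submodule.comap_inf] at a4 ⊢
      omega
    omega

theorem freeAux_indep_iff (M₁ : QMatroid K E₁) (M₂ : QMatroid K E₂)
    (I : Submodule K (E₁ × E₂)) : (freeAux M₁ M₂).Indep I ↔ I ∈ freeIndep M₁ M₂ := by
  change min _ _ = _ ↔ (_ = _ ∧ _ - _ ≥ _ - _)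
  rw [map_fst_inf_left]
  have h1 := finrank_comap_inl_add I
  have h2 := M₁.rank_le (I.comap (inl K E₁ E₂))
  have h3 := M₂.rank_le (I.map (snd K E₁ E₂))
  have h4 := M₁.mono (I.comap (inl K E₁ E₂)) ⊤ le_top
  omega

theorem sSup_freeIndep (M₁ : QMatroid K E₁) (M₂ : QMatroid K E₂) (X : Submodule K (E₁ × E₂)) :
    sSup {n | ∃ I ∈ freeIndep M₁ M₂, n = Module.finrank K (X ⊓ I : Submodule K (E₁ × E₂))} =
      (freeAux M₁ M₂).r X := by
  simp only [← freeAux_indep_iff]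
  exact sSup_indep_eq_rank _ X

/-- The free product `M₁ □ M₂`: the `q`-matroid on `E₁ ⊕ E₂` whose independent spaces are those
in `freeIndep M₁ M₂`, so that `r(X) = max {dim (X ∩ I) : I ∈ freeIndep M₁ M₂}`. -/
noncomputable def freeProduct (M₁ : QMatroid K E₁) (M₂ : QMatroid K E₂) :
    QMatroid K (E₁ × E₂) where
  r X := sSup {n | ∃ I ∈ freeIndep M₁ M₂, n = Module.finrank K (X ⊓ I : Submodule K (E₁ × E₂))}
  rank_le X := by
    rw [sSup_freeIndep]
    exact (freeAux M₁ M₂).rank_le X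
  mono X Y h := by
    rw [sSup_freeIndep, sSup_freeIndep]
    exact (freeAux M₁ M₂).mono X Y h
  submod X Y := by
    simp only [sSup_freeIndep]
    exact (freeAux M₁ M₂).submod X Y

/-- The collection used in the definition is the collection of independent spaces of the free
product. -/
theorem freeProduct_indep_iff (M₁ : QMatroid K E₁) (M₂ : QMatroid K E₂)
    (I : Submodule K (E₁ × E₂)) : (freeProduct M₁ M₂).Indep I ↔ I ∈ freeIndep M₁ M₂ := by
  rw [← freeAux_indep_iff, Indep, Indep, ← sSup_freeIndep]
  rfl

end FreeProduct

section Identification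

variable (K : Type v) (E₁ : Type u) (E₂ : Type w) [Field K]
  [AddCommGroup E₁] [Module K E₁] [AddCommGroup E₂] [Module K E₂]

/-- The canonical identification of `(E₁ ⊕ 0) ⊕ (E₁ ⊕ E₂)/(E₁ ⊕ 0)` with `E₁ ⊕ E₂`: the first
summand is `E₁` via `ι₁`, the second is `E₂` via the map induced by `π₂`. -/
noncomputable def leftProdQuot :
    (left K E₁ E₂ × ((E₁ × E₂) ⧸ left K E₁ E₂)) ≃ₗ[K] E₁ × E₂ :=
  (LinearEquiv.ofInjective (LinearMap.inl K E₁ E₂) LinearMap.inl_injective).symm.prodCongr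
    ((Submodule.quotEquivOfEq _ _ (LinearMap.range_inl K E₁ E₂)).trans
      ((LinearMap.snd K E₁ E₂).quotKerEquivOfSurjective LinearMap.snd_surjective))

theorem leftProdQuot_apply (a : left K E₁ E₂) (x : E₁ × E₂) :
    leftProdQuot K E₁ E₂ (a, (left K E₁ E₂).mkQ x) = (a.1.1, x.2) := by
  obtain ⟨_, b, rfl⟩ := a
  refine Prod.ext ?_ rfl
  exact (LinearEquiv.symm_apply_eq _).2 (Subtype.ext rfl)

end Identification

/-- A `q`-matroid is irreducible if it is not (isomorphic to) a free product of two `q`-matroids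
with non-zero ground spaces. -/
def IsIrreducible {K : Type v} {E : Type u} [Field K] [AddCommGroup E] [Module K E]
    (M : QMatroid K E) : Prop :=
  ∀ (V₁ V₂ : Type u) [AddCommGroup V₁] [Module K V₁] [FiniteDimensional K V₁]
    [AddCommGroup V₂] [Module K V₂] [FiniteDimensional K V₂]
    (M₁ : QMatroid K V₁) (M₂ : QMatroid K V₂),
    M.Iso (M₁.freeProduct M₂) → ¬ (Nontrivial V₁ ∧ Nontrivial V₂)

end QMatroid

/-! The rank of a free product is the smaller of two closed expressions. For `(M|A) □ (M/A)`, read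
on `E` along a splitting, they are r(V ∩ A) + dim V/(V ∩ A) and r(V + A). Both are at least r(V);
the first equals r(V) exactly when V and V ∩ A have the same nullity, the second exactly when A does
not raise the rank of V. So the free product recovers M iff one of these holds for every V.

`isFreeSeparator_iff` shows that this is the free separator condition. Its core is
`exists_isCyclicFlat`: each X shares its nullity with some W ≤ X that spans a cyclic flat, and
comparing that flat with A decides which alternative holds.

For irreducibility, a separator A splits M in this way, and conversely the first summand of any free
product is a free separator. -/

namespace QMatroid

/-! ### Nullity, cyclic flats and the rank criterion for free separators -/

section Cyclic

variable {K : Type v} {E : Type u} [Field K] [AddCommGroup E] [Module K E]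

theorem nullity_pos_iff (M : QMatroid K E) (A : Submodule K E) :
    0 < M.nullity A ↔ ¬ M.Indep A := by
  have h := M.rank_le A
  unfold nullity Indep
  omega

variable [FiniteDimensional K E]

theorem exists_isCircuit_le (M : QMatroid K E) {D : Submodule K E} (hD : ¬ M.Indep D) :
    ∃ C ≤ D, M.IsCircuit C :=
  exists_minimal_le_of_wellFoundedLT _ D hD

/-- A space all of whose proper subspaces have smaller nullity is a sum of circuits. -/
theorem isCyclic_of_forall_lt (M : QMatroid K E) {W : Submodule K E}
    (hW : ∀ H < W, M.r W + Module.finrank K H < M.r H + Module.finrank K W) : M.IsCyclic W := by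
  refine ⟨{C | M.IsCircuit C ∧ C ≤ W}, fun C hC => hC.1, ?_⟩
  have hle : sSup {C | M.IsCircuit C ∧ C ≤ W} ≤ W := sSup_le fun C hC => hC.2
  by_contra hne
  -- H is a hyperplane of W containing every circuit in W; a circuit in W outside H gives the
  -- contradiction.
  obtain ⟨H, hSH, hHW⟩ := exists_le_covBy_of_lt (lt_of_le_of_ne hle (Ne.symm hne))
  obtain ⟨x, hxW, hxH⟩ := SetLike.exists_of_lt hHW.lt
  have hxspan : Submodule.span K {x} ≤ W := (Submodule.span_singleton_le_iff_mem x W).2 hxW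
  have hsup : H ⊔ Submodule.span K {x} = W := by
    refine (hHW.eq_or_eq le_sup_left (sup_le hHW.le hxspan)).resolve_left fun h => hxH ?_
    rw [← h]
    exact Submodule.mem_sup_right (Submodule.mem_span_singleton_self x)
  have hx0 : x ≠ 0 := by
    rintro rfl
    exact hxH H.zero_mem
  have hdisj : H ⊓ Submodule.span K {x} = ⊥ :=
    ((Submodule.disjoint_span_singleton' hx0).2 hxH).eq_bot
  have hx1 : Module.finrank K (Submodule.span K {x}) = 1 := finrank_span_singleton hx0
  obtain ⟨I, hIH, hI, hrI⟩ := M.exists_indep_le H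
  have hIx : I ⊓ Submodule.span K {x} = ⊥ :=
    le_bot_iff.1 ((inf_le_inf_right _ hIH).trans hdisj.le)
  -- The hypothesis on H forces r(W) ≤ r(H), while this space has dimension r(H) + 1.
  have hdep : ¬ M.Indep (I ⊔ Submodule.span K {x}) := by
    intro h
    have h1 := M.mono (I ⊔ Submodule.span K {x}) W (sup_le (hIH.trans hHW.le) hxspan)
    have h2 := hW H hHW.lt
    have h3 := Submodule.finrank_sup_add_finrank_inf_eq I (Submodule.span K {x})
    have h4 := Submodule.finrank_sup_add_finrank_inf_eq H (Submodule.span K {x})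
    rw [hIx] at h3
    rw [hsup, hdisj] at h4
    simp only [finrank_bot] at h3 h4
    unfold Indep at h
    omega
  obtain ⟨C, hC, hCcirc⟩ := M.exists_isCircuit_le hdep
  have hCH : C ≤ H :=
    (le_sSup (show C ∈ {C | M.IsCircuit C ∧ C ≤ W} from
      ⟨hCcirc, hC.trans (sup_le (hIH.trans hHW.le) hxspan)⟩)).trans hSH
  -- By the modular law, (I + ⟨x⟩) ∩ H = I.
  have hCI : C ≤ I := by
    have h := le_inf hC hCH
    rwa [sup_inf_assoc_of_le _ hIH, inf_comm, hdisj, sup_bot_eq] at h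
  exact hCcirc.prop (M.indep_of_le C I hCI hI)

/-- Nullity is supermodular. -/
theorem nullity_supermodular (M : QMatroid K E) (A B : Submodule K E) :
    M.nullity A + M.nullity B ≤ M.nullity (A ⊔ B) + M.nullity (A ⊓ B) := by
  have h1 := Submodule.finrank_sup_add_finrank_inf_eq A B
  have h2 := M.submod A B
  have h3 := M.rank_le A
  have h4 := M.rank_le B
  have h5 := M.rank_le (A ⊔ B)
  have h6 := M.rank_le (A ⊓ B)
  unfold nullity
  omega

theorem nullity_mono (M : QMatroid K E) {A B : Submodule K E} (h : A ≤ B) :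
    M.nullity A ≤ M.nullity B := by
  have h1 := M.rank_add_finrank_le A B h
  unfold nullity
  omega

theorem isCyclic_of_forall_nullity_lt (M : QMatroid K E) {W : Submodule K E}
    (hW : ∀ H < W, M.nullity H < M.nullity W) : M.IsCyclic W := by
  refine M.isCyclic_of_forall_lt fun H hH => ?_
  have h1 := hW H hH
  have h2 := M.rank_le H
  have h3 := M.rank_le W
  unfold nullity at h1
  omega

/-- Every space `X` contains a space of the same nullity whose closure is a cyclic flat. -/
theorem exists_isCyclicFlat (M : QMatroid K E) (X : Submodule K E) :
    ∃ W Z, W ≤ X ∧ W ≤ Z ∧ M.nullity W = M.nullity X ∧ M.r Z = M.r W ∧ M.IsCyclicFlat Z := by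
  -- By minimality every proper subspace of W has smaller nullity; this property passes to the
  -- closure Z of W.
  obtain ⟨W, hWX, hW⟩ := exists_minimal_le_of_wellFoundedLT
    (fun V => M.nullity X ≤ M.nullity V) X le_rfl
  obtain ⟨Z, hWZ, hZ⟩ := exists_maximal_ge_of_wellFoundedGT (fun V => M.r V = M.r W) W rfl
  have hWn : M.nullity W = M.nullity X := le_antisymm (M.nullity_mono hWX) hW.prop
  refine ⟨W, Z, hWX, hWZ, hWn, hZ.prop, ?_, ?_⟩
  · unfold IsFlat
    rw [hZ.prop]
    exact hZ
  · refine M.isCyclic_of_forall_nullity_lt fun H hH => ?_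
    -- If W ≤ H < Z, then H has the rank of Z but smaller dimension. Otherwise H ∩ W loses nullity
    -- against W, and supermodularity carries the loss to H against Z.
    by_cases hWH : W ≤ H
    · have h1 := M.mono _ _ hWH
      have h2 := hZ.prop
      have h3 := Submodule.finrank_lt_finrank_of_lt hH
      have h4 := M.rank_le H
      unfold nullity
      omega
    · have h1 : ¬ M.nullity X ≤ M.nullity (H ⊓ W) :=
        hW.not_prop_of_lt (inf_lt_right.2 hWH)
      have h2 := M.nullity_supermodular H W
      have h3 := M.nullity_mono (sup_le hH.le hWZ)
      omega

/-- A space `A` is a free separator iff every space `X` has the nullity of `X ∩ A` or the rank of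
`X + A`. -/
theorem isFreeSeparator_iff (M : QMatroid K E) (A : Submodule K E) :
    M.IsFreeSeparator A ↔ ∀ X, M.nullity X = M.nullity (X ⊓ A) ∨ M.r X = M.r (X ⊔ A) := by
  constructor
  · intro hA X
    obtain ⟨W, Z, hWX, hWZ, hn, hr, hZ⟩ := M.exists_isCyclicFlat X
    rcases hA Z hZ with h | h
    · left
      refine le_antisymm ?_ (M.nullity_mono inf_le_left)
      rw [← hn]
      exact M.nullity_mono (le_inf hWX (hWZ.trans h))
    · right
      -- Since r(X ∩ Z) ≥ r(W) = r(Z), submodularity gives r(X + Z) ≤ r(X), and X + A ≤ X + Z.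
      have h1 := M.submod X Z
      have h2 := M.mono _ _ (le_inf hWX hWZ)
      have h3 := M.mono _ _ (sup_le_sup_left h X)
      have h4 := M.mono X (X ⊔ A) le_sup_left
      omega
  · intro h Z hZ
    rcases h Z with hn | hr
    · left
      obtain ⟨S, hS, rfl⟩ := hZ.2
      refine sSup_le fun C hC => ?_
      have hCle : C ≤ sSup S := le_sSup hC
      -- As Z and Z ∩ A have equal nullity, supermodularity gives C ∩ A at least the positive
      -- nullity of C; minimality of the circuit then puts C inside A.
      have h1 := M.nullity_supermodular C (sSup S ⊓ A)
      have h2 := M.nullity_mono (sup_le hCle (inf_le_left : sSup S ⊓ A ≤ sSup S))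
      have h3 := (M.nullity_pos_iff C).2 (hS C hC).prop
      have h4 : ¬ M.Indep (C ⊓ (sSup S ⊓ A)) := (M.nullity_pos_iff _).1 (by omega)
      exact ((hS C hC).le_of_le h4 inf_le_left).trans (inf_le_right.trans inf_le_right)
    · right
      exact le_sup_right.trans (hZ.1.le_of_ge (hr ▸ rfl : M.r (Z ⊔ A) = M.r Z) le_sup_left)

end Cyclic

/-! ### Rank of the free product -/

section FreeProductRank

open LinearMap (inl fst snd)

variable {K : Type v} {E₁ : Type u} {E₂ : Type w} [Field K]
  [AddCommGroup E₁] [Module K E₁] [AddCommGroup E₂] [Module K E₂]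
  [FiniteDimensional K E₁] [FiniteDimensional K E₂]

theorem freeProduct_rank (M₁ : QMatroid K E₁) (M₂ : QMatroid K E₂) (X : Submodule K (E₁ × E₂)) :
    (M₁.freeProduct M₂).r X =
      min (M₁.r (X.comap (inl K E₁ E₂)) + Module.finrank K (X.map (snd K E₁ E₂)))
        (M₁.r ⊤ + M₂.r (X.map (snd K E₁ E₂))) :=
  sSup_freeIndep M₁ M₂ X

/-- Where the first term of the minimum is attained, the nullity of X is that of X ∩ (E₁ ⊕ 0) in M₁;
where the second is attained, it is already the rank of X + (E₁ ⊕ 0). -/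
theorem isFreeSeparator_left_freeProduct (M₁ : QMatroid K E₁) (M₂ : QMatroid K E₂) :
    (M₁.freeProduct M₂).IsFreeSeparator (left K E₁ E₂) := by
  rw [isFreeSeparator_iff]
  intro X
  have c1 : (X ⊓ left K E₁ E₂).comap (inl K E₁ E₂) = X.comap (inl K E₁ E₂) := by
    ext x
    simp
  have c2 : (X ⊓ left K E₁ E₂).map (snd K E₁ E₂) = ⊥ := by
    rw [eq_bot_iff, Submodule.map_le_iff_le_comap]
    exact inf_le_right.trans (LinearMap.range_inl K E₁ E₂).le
  have c3 : (X ⊔ left K E₁ E₂).comap (inl K E₁ E₂) = ⊤ := by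
    rw [eq_top_iff]
    exact fun x _ => Submodule.mem_sup_right ⟨x, rfl⟩
  have c4 : (X ⊔ left K E₁ E₂).map (snd K E₁ E₂) = X.map (snd K E₁ E₂) := by
    rw [Submodule.map_sup, sup_eq_left, Submodule.map_le_iff_le_comap]
    rintro _ ⟨x, rfl⟩
    simp
  have d1 := finrank_comap_inl_add X
  have d2 := finrank_comap_inl_add (X ⊓ left K E₁ E₂)
  have e1 := M₁.rank_le (X.comap (inl K E₁ E₂))
  have e2 := M₁.mono (X.comap (inl K E₁ E₂)) ⊤ le_top
  have e3 := M₂.rank_le (X.map (snd K E₁ E₂))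
  have e4 := M₂.rank_le ⊥
  have f1 := freeProduct_rank M₁ M₂ X
  have f2 := freeProduct_rank M₁ M₂ (X ⊓ left K E₁ E₂)
  have f3 := freeProduct_rank M₁ M₂ (X ⊔ left K E₁ E₂)
  rw [c1, c2] at d2 f2
  rw [c3, c4] at f3
  rw [finrank_bot] at d2 e4 f2
  unfold nullity
  omega

end FreeProductRank

/-! ### Splitting along a free separator, and irreducibility -/

section Decomposition

open LinearMap (inl fst snd)

variable {K : Type v} {E : Type u} [Field K] [AddCommGroup E] [Module K E]

/-- A choice of complement gives τ. The two listed properties are all that the rank computation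
needs, so the choice does not matter. -/
theorem exists_equiv_prod_quotient (A : Submodule K E) :
    ∃ τ : E ≃ₗ[K] A × (E ⧸ A), (∀ a : A, τ a = (a, 0)) ∧ ∀ x, (τ x).2 = A.mkQ x := by
  obtain ⟨B, hB⟩ := Submodule.exists_isCompl A
  let σ : (A × (E ⧸ A)) ≃ₗ[K] E :=
    ((LinearEquiv.refl K A).prodCongr (Submodule.quotientEquivOfIsCompl A B hB)).trans
      (Submodule.prodEquivOfIsCompl A B hB)
  have hσ : ∀ p, A.mkQ (σ p) = p.2 := by
    intro p
    have : σ p = p.1 + (Submodule.quotientEquivOfIsCompl A B hB p.2 : E) := rfl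
    rw [this, map_add, A.mkQ_apply, (Submodule.Quotient.mk_eq_zero A).2 p.1.2, zero_add,
      A.mkQ_apply, Submodule.mk_quotientEquivOfIsCompl_apply]
  refine ⟨σ.symm, fun a => ?_, fun x => ?_⟩
  · rw [LinearEquiv.symm_apply_eq]
    simp [σ]
  · rw [← hσ, LinearEquiv.apply_symm_apply]

variable [FiniteDimensional K E]

/-- The rank function of `(M|A) □ (M/A)`, read on `E` along a splitting `E ≃ A ⊕ E/A`. -/
theorem restrict_freeProduct_contract_rank (M : QMatroid K E) (A : Submodule K E)
    (τ : E ≃ₗ[K] A × (E ⧸ A)) (h1 : ∀ a : A, τ a = (a, 0)) (h2 : ∀ x, (τ x).2 = A.mkQ x)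
    (V : Submodule K E) :
    ((M.restrict A).freeProduct (M.contract A)).r (V.map τ.toLinearMap) =
      min (M.r (V ⊓ A) + Module.finrank K (V.map A.mkQ)) (M.r (V ⊔ A)) := by
  have c1 : ((V.map τ.toLinearMap).comap (inl K A (E ⧸ A))).map A.subtype = V ⊓ A := by
    ext x
    simp only [Submodule.mem_map, Submodule.mem_comap, Submodule.mem_inf]
    constructor
    · rintro ⟨a, ⟨v, hv, hva⟩, rfl⟩
      obtain rfl : v = a := τ.injective (hva.trans (h1 a).symm)
      exact ⟨hv, a.2⟩
    · rintro ⟨hV, hA⟩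
      exact ⟨⟨x, hA⟩, ⟨x, hV, h1 ⟨x, hA⟩⟩, rfl⟩
  have c2 : (V.map τ.toLinearMap).map (snd K A (E ⧸ A)) = V.map A.mkQ := by
    rw [← Submodule.map_comp]
    congr 1
    exact LinearMap.ext h2
  have c3 : (⊤ : Submodule K A).map A.subtype = A := by simp
  have c4 : (V.map A.mkQ).comap A.mkQ = V ⊔ A := by
    rw [Submodule.comap_map_mkQ, sup_comm]
  have h3 := M.mono A (V ⊔ A) le_sup_right
  rw [freeProduct_rank, c2]
  simp only [restrict, contract, c1, c3, c4]
  rw [Nat.add_sub_cancel' h3]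

theorem isFreeSeparator_iff_freeProduct_rank (M : QMatroid K E) (A : Submodule K E)
    (τ : E ≃ₗ[K] A × (E ⧸ A)) (h1 : ∀ a : A, τ a = (a, 0)) (h2 : ∀ x, (τ x).2 = A.mkQ x) :
    M.IsFreeSeparator A ↔ ∀ V : Submodule K E,
      ((M.restrict A).freeProduct (M.contract A)).r (V.map τ.toLinearMap) = M.r V := by
  rw [isFreeSeparator_iff]
  refine forall_congr' fun V => ?_
  rw [M.restrict_freeProduct_contract_rank A τ h1 h2]
  have d1 := finrank_map_add_finrank_inf_ker A.mkQ V
  rw [Submodule.ker_mkQ] at d1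
  have d2 := M.rank_add_finrank_le (V ⊓ A) V inf_le_left
  have d3 := M.rank_le V
  have d4 := M.rank_le (V ⊓ A)
  have d5 := M.mono V (V ⊔ A) le_sup_left
  unfold nullity
  omega

theorem isIrreducible_iff (M : QMatroid K E) :
    M.IsIrreducible ↔ ¬ ∃ A : Submodule K E, M.IsFreeSeparator A ∧ A ≠ ⊥ ∧ A ≠ ⊤ := by
  constructor
  · rintro hM ⟨A, hA, hbot, htop⟩
    obtain ⟨τ, h1, h2⟩ := exists_equiv_prod_quotient A
    exact hM A (E ⧸ A) (M.restrict A) (M.contract A)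
      ⟨τ, (M.isFreeSeparator_iff_freeProduct_rank A τ h1 h2).1 hA⟩
      ⟨Submodule.nontrivial_iff_ne_bot.2 hbot, Submodule.Quotient.nontrivial_iff.2 htop⟩
  · rintro hM V₁ V₂ _ _ _ _ _ _ M₁ M₂ ⟨τ, hτ⟩ ⟨_, _⟩
    -- The separator of the product is pulled back along τ. Only ranks and nullities enter the
    -- criterion, so no circuits or flats need transporting.
    refine hM ⟨(left K V₁ V₂).comap τ.toLinearMap, ?_, fun h => ?_, fun h => ?_⟩
    · have hN := (isFreeSeparator_iff _ _).1 (isFreeSeparator_left_freeProduct M₁ M₂)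
      rw [isFreeSeparator_iff]
      intro X
      have hc : ((left K V₁ V₂).comap τ.toLinearMap).map τ.toLinearMap = left K V₁ V₂ :=
        Submodule.map_comap_eq_of_surjective τ.surjective _
      have hd : ∀ V : Submodule K E,
          (M₁.freeProduct M₂).nullity (V.map τ.toLinearMap) = M.nullity V := fun V => by
        unfold nullity
        rw [hτ, LinearEquiv.finrank_map_eq]
      have h := hN (X.map τ.toLinearMap)
      rwa [← hc, ← Submodule.map_inf _ τ.injective, ← Submodule.map_sup, hd, hd, hτ, hτ] at h
    · obtain ⟨v, hv⟩ := exists_ne (0 : V₁)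
      have hmem : τ.symm (v, 0) ∈ (left K V₁ V₂).comap τ.toLinearMap := ⟨v, by simp⟩
      rw [h, Submodule.mem_bot, LinearEquiv.map_eq_zero_iff] at hmem
      exact hv (congrArg Prod.fst hmem)
    · obtain ⟨v, hv⟩ := exists_ne (0 : V₂)
      have hmem : τ.symm (0, v) ∈ (left K V₁ V₂).comap τ.toLinearMap := h ▸ Submodule.mem_top
      obtain ⟨w, hw⟩ := hmem
      exact hv (by simpa using (congrArg Prod.snd hw).symm)

end Decomposition

/-! ### The canonical identification for E₁ ⊕ E₂ -/

section Left

variable {K : Type v} {E₁ : Type u} {E₂ : Type w} [Field K]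
  [AddCommGroup E₁] [Module K E₁] [AddCommGroup E₂] [Module K E₂]

theorem leftProdQuot_symm_apply (x : E₁ × E₂) :
    (leftProdQuot K E₁ E₂).symm x = (⟨(x.1, 0), x.1, rfl⟩, (left K E₁ E₂).mkQ x) := by
  rw [LinearEquiv.symm_apply_eq, leftProdQuot_apply]

/-- The inverse of `leftProdQuot` is itself a splitting of the kind required by
`isFreeSeparator_iff_freeProduct_rank`. -/
theorem eq_freeProduct_map_iff [FiniteDimensional K E₁] [FiniteDimensional K E₂]
    (M : QMatroid K (E₁ × E₂)) :
    M = ((M.restrict (left K E₁ E₂)).freeProduct (M.contract (left K E₁ E₂))).map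
        (leftProdQuot K E₁ E₂) ↔ M.IsFreeSeparator (left K E₁ E₂) := by
  rw [M.isFreeSeparator_iff_freeProduct_rank _ (leftProdQuot K E₁ E₂).symm ?_ ?_, QMatroid.ext_iff,
    funext_iff]
  · exact forall_congr' fun V => eq_comm
  · rintro ⟨_, b, rfl⟩
    rw [leftProdQuot_symm_apply]
    exact Prod.ext rfl ((Submodule.Quotient.mk_eq_zero _).2 ⟨b, rfl⟩)
  · intro x
    rw [leftProdQuot_symm_apply]

end Left

end QMatroid

theorem mainTheorem5 {K : Type v} [Field K] [Finite K] :
    -- a direct sum decomposition comes from the free product iff its first summand is a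
    -- free separator
    (∀ (E₁ : Type u) (E₂ : Type w) [AddCommGroup E₁] [Module K E₁] [FiniteDimensional K E₁]
      [AddCommGroup E₂] [Module K E₂] [FiniteDimensional K E₂] (M : QMatroid K (E₁ × E₂)),
      M = ((M.restrict (QMatroid.left K E₁ E₂)).freeProduct
            (M.contract (QMatroid.left K E₁ E₂))).map (QMatroid.leftProdQuot K E₁ E₂) ↔
        M.IsFreeSeparator (QMatroid.left K E₁ E₂)) ∧
    -- irreducibility
    (∀ (E : Type t) [AddCommGroup E] [Module K E] [FiniteDimensional K E] [Nontrivial E]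
      (M : QMatroid K E),
      M.IsIrreducible ↔ ¬ ∃ A : Submodule K E, M.IsFreeSeparator A ∧ A ≠ ⊥ ∧ A ≠ ⊤) := by
  exact ⟨fun E₁ E₂ _ _ _ _ _ _ M => M.eq_freeProduct_map_iff,
    fun E _ _ _ _ M => M.isIrreducible_iff⟩
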